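/- Let $X_1,X_2,\ldots$ be i.i.d. random variables, uniformly distributed on $[-1,1]$. For $\theta\in\mathbb{R}$ let $Y_0=0$ and $Y_k=\theta Y_{k-1}+X_k$ for $k\ge1$, and put $$p_n^U(\theta)=\mathbb{P}[Y_1\ge 0,\ldots,Y_n\ge 0]\quad (n\ge 0),\qquad\text{so that } p_0^U(\theta)=1.$$ For every $n\ge0$ the function $\theta\mapsto p_n^U(\theta)$ is $C^\infty$ on $(-\infty,-1)\cup(-1,\tfrac12)$. Moreover: (a) For every $n\ge1$, $\theta\mapsto p_n^U(\theta)$ is $C^1$ at $\theta=-1$, i.e. continuously differentiable in a neighbourhood of $-1$. (b) For every $n\ge2$, $\theta\mapsto p_n^U(\theta)$ is not $C^2$ at $\theta=-1$, and $(p_n^U)''$ is discontinuous there: the one-sided limits $(p_n^U)''(-1^-)=\lim_{\theta\uparrow-1}(p_n^U)''(\theta)$ and $(p_n^U)''(-1^+)=\lim_{\theta\downarrow-1}(p_n^U)''(\theta)$ exist in $\mathbb{R}$, satisfy $(p_n^U)''(-1^-)>(p_n^U)''(-1^+)$, and $$(p_n^U)''(-1^-)-(p_n^U)''(-1^+)=\frac{p_{n-2}^U(-1)}{4}.$$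 Thus $\theta\mapsto p_n^U(\theta)$ has a phase transition of order $2$ at $\theta=-1$ for each $n\ge2$. -/

import Mathlib

open MeasureTheory ProbabilityTheory Filter Set
open scoped Topology ContDiff

/-- The autoregressive sequence of order one with drift `θ`: `Y₀ = 0`, `Yₙ = θ Yₙ₋₁ + Xₙ` for
`n ≥ 1`. The innovations are enumerated from zero, so that `X k` is the `(k+1)`-st innovation. -/
def arProcess {Ω : Type*} (X : ℕ → Ω → ℝ) (θ : ℝ) : ℕ → Ω → ℝ
  | 0, _ => 0
  | k + 1, w => θ * arProcess X θ k w + X k w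

/-- The persistence probability `pₙ(θ) = P[Y₁ ≥ 0, …, Yₙ ≥ 0]`; in particular `p₀(θ) = 1`. -/
noncomputable def persistenceProb {Ω : Type*} [MeasurableSpace Ω] (P : Measure Ω)
    (X : ℕ → Ω → ℝ) (n : ℕ) (θ : ℝ) : ℝ :=
  P.real {w | ∀ k : ℕ, 1 ≤ k → k ≤ n → 0 ≤ arProcess X θ k w}

/-- A function of two real variables that is given by a polynomial. -/
def IsPolyTwo (F : ℝ → ℝ → ℝ) : Prop :=
  ∃ p : MvPolynomial (Fin 2) ℝ, ∀ s x, F s x = MvPolynomial.eval ![s, x] p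

theorem MvPolynomial.contDiff_eval_pair (p : MvPolynomial (Fin 2) ℝ) :
    ContDiff ℝ ∞ fun z : ℝ × ℝ => MvPolynomial.eval ![z.1, z.2] p := by
  induction p using MvPolynomial.induction_on with
  | C a => simpa using contDiff_const
  | add p q hp hq => simpa using hp.add hq
  | mul_X p i hp =>
    simp only [map_mul, MvPolynomial.eval_X]
    refine hp.mul ?_
    fin_cases i
    · simpa using contDiff_fst
    · simpa using contDiff_snd

theorem IsPolyTwo.contDiff {F : ℝ → ℝ → ℝ} (hF : IsPolyTwo F) :
    ContDiff ℝ ∞ fun z : ℝ × ℝ => F z.1 z.2 := by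
  obtain ⟨p, hp⟩ := hF
  simpa only [hp] using p.contDiff_eval_pair

theorem IsPolyTwo.continuous {F : ℝ → ℝ → ℝ} (hF : IsPolyTwo F) (s : ℝ) : Continuous (F s) :=
  hF.contDiff.continuous.comp (Continuous.prodMk_right s)

theorem IsPolyTwo.comp {F G : ℝ → ℝ → ℝ} (hF : IsPolyTwo F) (hG : IsPolyTwo G) :
    IsPolyTwo fun s x => F s (G s x) := by
  obtain ⟨p, hp⟩ := hF
  obtain ⟨q, hq⟩ := hG
  refine ⟨MvPolynomial.bind₁ ![MvPolynomial.X 0, q] p, fun s x => ?_⟩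
  simp only [hp, hq]
  rw [← MvPolynomial.coe_aeval_eq_eval, ← MvPolynomial.coe_aeval_eq_eval]
  simp only [RingHom.coe_coe]
  rw [MvPolynomial.aeval_bind₁]
  congr 2
  ext i
  fin_cases i <;> simp

theorem MvPolynomial.exists_primitive (p : MvPolynomial (Fin 2) ℝ) :
    ∃ q : MvPolynomial (Fin 2) ℝ, ∀ s u,
      ∫ y in (0 : ℝ)..u, MvPolynomial.eval ![s, y] p = MvPolynomial.eval ![s, u] q := by
  induction p using MvPolynomial.induction_on' with
  | monomial m a =>
    refine ⟨MvPolynomial.C (a / (m 1 + 1)) * MvPolynomial.X 0 ^ m 0 *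
      MvPolynomial.X 1 ^ (m 1 + 1), fun s u => ?_⟩
    simp [MvPolynomial.eval_monomial, Finsupp.prod_fintype, Fin.prod_univ_two, ← mul_assoc]
    ring
  | add p q hp hq =>
    obtain ⟨p', hp⟩ := hp
    obtain ⟨q', hq⟩ := hq
    refine ⟨p' + q', fun s u => ?_⟩
    have hc : ∀ r : MvPolynomial (Fin 2) ℝ,
        IntervalIntegrable (fun y => MvPolynomial.eval ![s, y] r) volume 0 u := fun r =>
      (r.contDiff_eval_pair.continuous.comp (Continuous.prodMk_right s)).intervalIntegrable _ _
    simp only [map_add]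
    rw [intervalIntegral.integral_add (hc p) (hc q), hp, hq]

theorem IsPolyTwo.primitive {F : ℝ → ℝ → ℝ} (hF : IsPolyTwo F) :
    IsPolyTwo fun s u => ∫ y in (0 : ℝ)..u, F s y := by
  obtain ⟨p, hp⟩ := hF
  obtain ⟨q, hq⟩ := p.exists_primitive
  exact ⟨q, fun s u => by simp only [hp, hq]⟩

/-- Iterated signed integrals `f₀ = 1`, `fₖ₊₁ x = ∫₀^{1 + θ x} fₖ`. -/
noncomputable def polyIter (θ : ℝ) : ℕ → ℝ → ℝ
  | 0, _ => 1
  | k + 1, x => ∫ y in (0 : ℝ)..(1 + θ * x), polyIter θ k y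

/-- Iterated integrals `r₀ = 1`, `rₖ₊₁ y = ∫₀^{s (1 - y)} rₖ`. -/
noncomputable def dualIter (s : ℝ) : ℕ → ℝ → ℝ
  | 0, _ => 1
  | k + 1, y => ∫ x in (0 : ℝ)..(s * (1 - y)), dualIter s k x

theorem isPolyTwo_polyIter (k : ℕ) : IsPolyTwo fun θ => polyIter θ k := by
  induction k with
  | zero => exact ⟨1, fun s x => by simp [polyIter]⟩
  | succ k ih =>
    exact ih.primitive.comp (G := fun s x => 1 + s * x)
      ⟨1 + MvPolynomial.X 0 * MvPolynomial.X 1, fun s x => by simp⟩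

theorem isPolyTwo_dualIter (k : ℕ) : IsPolyTwo fun s => dualIter s k := by
  induction k with
  | zero => exact ⟨1, fun s x => by simp [dualIter]⟩
  | succ k ih =>
    exact ih.primitive.comp (G := fun s x => s * (1 - x))
      ⟨MvPolynomial.X 0 * (1 - MvPolynomial.X 1), fun s x => by simp⟩

theorem continuous_polyIter (θ : ℝ) (k : ℕ) : Continuous (polyIter θ k) :=
  (isPolyTwo_polyIter k).continuous θ

theorem continuous_dualIter (s : ℝ) (k : ℕ) : Continuous (dualIter s k) :=
  (isPolyTwo_dualIter k).continuous s

theorem contDiff_polyIter_zero (n : ℕ) : ContDiff ℝ ∞ fun θ => polyIter θ n 0 :=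
  (isPolyTwo_polyIter n).contDiff.comp (contDiff_id.prodMk contDiff_const)

theorem contDiff_integral_dualIter (n : ℕ) :
    ContDiff ℝ ∞ fun s => ∫ y in (0 : ℝ)..1, dualIter s n y :=
  (isPolyTwo_dualIter n).primitive.contDiff.comp (contDiff_id.prodMk contDiff_const)

theorem polyIter_neg_one_pos (n : ℕ) {x : ℝ} (hx0 : 0 ≤ x) (hx1 : x < 1) :
    0 < polyIter (-1) n x := by
  induction n generalizing x with
  | zero => simp [polyIter]
  | succ n ih =>
    refine intervalIntegral.intervalIntegral_pos_of_pos_on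
      ((continuous_polyIter _ _).intervalIntegrable _ _) (fun y hy => ih hy.1.le ?_) (by linarith)
    linarith [hy.2]

/-- The positive operator `f ↦ ∫₀^{(1 + θ x)⁺} f`. -/
noncomputable def truncOp (θ : ℝ) (f : ℝ → ℝ) (x : ℝ) : ℝ :=
  ∫ y in (0 : ℝ)..max 0 (1 + θ * x), f y

theorem continuous_truncOp (θ : ℝ) {f : ℝ → ℝ} (hf : Continuous f) : Continuous (truncOp θ f) :=
  (intervalIntegral.continuous_primitive (fun a b => hf.intervalIntegrable a b) 0).comp
    (by fun_prop : Continuous fun x => max 0 (1 + θ * x))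

/-- The iterates `(truncOp θ)^n 1`. -/
noncomputable def truncIter (θ : ℝ) (n : ℕ) : ℝ → ℝ := (truncOp θ)^[n] fun _ => 1

theorem truncIter_zero (θ x : ℝ) : truncIter θ 0 x = 1 := rfl

theorem truncIter_succ (θ : ℝ) (n : ℕ) : truncIter θ (n + 1) = truncOp θ (truncIter θ n) :=
  Function.iterate_succ_apply' _ _ _

theorem continuous_truncIter (θ : ℝ) (n : ℕ) : Continuous (truncIter θ n) := by
  induction n with
  | zero => exact continuous_const
  | succ n ih => rw [truncIter_succ]; exact continuous_truncOp θ ih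

theorem truncIter_nonneg (θ : ℝ) (n : ℕ) (x : ℝ) : 0 ≤ truncIter θ n x := by
  induction n generalizing x with
  | zero => exact zero_le_one
  | succ n ih =>
    rw [truncIter_succ]
    exact intervalIntegral.integral_nonneg (le_max_left _ _) fun y _ => ih y

theorem truncIter_eq_polyIter {θ b : ℝ} (hb : ∀ x ∈ Icc 0 b, 1 + θ * x ∈ Icc 0 b) (n : ℕ) {x : ℝ}
    (hx : x ∈ Icc 0 b) : truncIter θ n x = polyIter θ n x := by
  induction n generalizing x with
  | zero => rfl
  | succ n ih =>
    obtain ⟨h0, h1⟩ := hb x hx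
    rw [truncIter_succ, truncOp, polyIter, max_eq_right h0]
    refine intervalIntegral.integral_congr fun y hy => ih ?_
    rw [uIcc_of_le h0] at hy
    exact ⟨hy.1, hy.2.trans h1⟩

theorem truncIter_zero_eq_polyIter {θ : ℝ} (h1 : -1 ≤ θ) (h2 : θ ≤ 1 / 2) (n : ℕ) :
    truncIter θ n 0 = polyIter θ n 0 := by
  rcases le_total θ 0 with h | h
  · refine truncIter_eq_polyIter (b := 1) (fun x hx => ?_) n (by simp)
    constructor <;> nlinarith [hx.1, hx.2]
  · refine truncIter_eq_polyIter (b := 2) (fun x hx => ?_) n (by simp)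
    constructor <;> nlinarith [hx.1, hx.2]

/-- Adjointness of `truncOp θ` and the dual recursion, for `θ ≤ -1`. -/
theorem integral_mul_truncOp {θ : ℝ} (hθ : θ ≤ -1) {f g : ℝ → ℝ} (hf : Continuous f)
    (hg : Continuous g) :
    ∫ x in (0 : ℝ)..1, f x * truncOp θ g x =
      ∫ y in (0 : ℝ)..1, (∫ x in (0 : ℝ)..(-θ⁻¹ * (1 - y)), f x) * g y := by
  have hθ0 : θ ≠ 0 := by linarith
  set s := -θ⁻¹ with hs
  have hθs : θ * s = -1 := by rw [hs]; field_simp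
  have hs0 : 0 < s := by rw [hs]; exact neg_pos.2 (inv_lt_zero.2 (by linarith))
  have hs1 : s ≤ 1 := by nlinarith
  have hi : ∀ a b, IntervalIntegrable (fun x => f x * truncOp θ g x) volume a b := fun a b =>
    (hf.mul (continuous_truncOp θ hg)).intervalIntegrable a b
  have htail : ∫ x in s..1, f x * truncOp θ g x = 0 := by
    rw [← intervalIntegral.integral_zero (a := s) (b := 1)]
    refine intervalIntegral.integral_congr fun x hx => ?_
    rw [uIcc_of_le hs1] at hx
    have : 1 + θ * x ≤ 0 := by nlinarith [hx.1]
    simp [truncOp, max_eq_left this]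
  have hF : ∀ x, HasDerivAt (fun x => ∫ t in (0 : ℝ)..x, f t) (f x) x := fun x =>
    intervalIntegral.integral_hasDerivAt_right (hf.intervalIntegrable _ _)
      (hf.stronglyMeasurableAtFilter _ _) hf.continuousAt
  have hG : ∀ x, HasDerivAt (fun x => ∫ t in (0 : ℝ)..(1 + θ * x), g t) (g (1 + θ * x) * θ) x := by
    intro x
    have h1 : HasDerivAt (fun x => ∫ t in (0 : ℝ)..x, g t) (g (1 + θ * x)) (1 + θ * x) :=
      intervalIntegral.integral_hasDerivAt_right (hg.intervalIntegrable _ _)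
        (hg.stronglyMeasurableAtFilter _ _) hg.continuousAt
    have h2 : HasDerivAt (fun x => 1 + θ * x) θ x := by
      simpa using ((hasDerivAt_id x).const_mul θ).const_add 1
    exact h1.comp x h2
  have hparts := intervalIntegral.integral_mul_deriv_eq_deriv_mul (a := 0) (b := s)
    (fun x _ => hF x) (fun x _ => hG x) (hf.intervalIntegrable _ _)
    ((by fun_prop : Continuous fun x => g (1 + θ * x) * θ).intervalIntegrable _ _)
  have hs' : 1 + θ * s = 0 := by linarith
  simp only [hs', intervalIntegral.integral_same, mul_zero, zero_mul, sub_zero, zero_sub] at hparts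
  rw [← intervalIntegral.integral_add_adjacent_intervals (hi 0 s) (hi s 1), htail, add_zero]
  have hhead : ∫ x in (0 : ℝ)..s, f x * truncOp θ g x =
      ∫ x in (0 : ℝ)..s, f x * ∫ t in (0 : ℝ)..(1 + θ * x), g t := by
    refine intervalIntegral.integral_congr fun x hx => ?_
    rw [uIcc_of_le hs0.le] at hx
    have : 0 ≤ 1 + θ * x := by nlinarith [hx.2]
    simp only [truncOp, max_eq_right this]
  have hsubst := intervalIntegral.integral_comp_mul_add (a := 0) (b := s)
    (fun y => (∫ x in (0 : ℝ)..(s * (1 - y)), f x) * g y) hθ0 1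
  have harg : ∀ x, s * (1 - (θ * x + 1)) = x := fun x => by linear_combination (-x) * hθs
  simp only [harg] at hsubst
  have hs'' : θ * s + 1 = 0 := by linarith
  rw [hs'', mul_zero, zero_add, intervalIntegral.integral_symm 0 1, smul_eq_mul] at hsubst
  rw [hhead, ← neg_eq_iff_eq_neg.2 hparts]
  have : (∫ x in (0 : ℝ)..s, (∫ t in (0 : ℝ)..x, f t) * (g (1 + θ * x) * θ)) =
      θ * ∫ x in (0 : ℝ)..s, (∫ t in (0 : ℝ)..x, f t) * g (θ * x + 1) := by
    rw [← intervalIntegral.integral_const_mul]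
    congr 1
    ext x
    rw [add_comm (θ * x)]
    ring
  rw [this, hsubst]
  field_simp

theorem iterate_truncOp_zero {θ : ℝ} (hθ : θ ≤ -1) (n : ℕ) {g : ℝ → ℝ} (hg : Continuous g) :
    (truncOp θ)^[n + 1] g 0 = ∫ y in (0 : ℝ)..1, dualIter (-θ⁻¹) n y * g y := by
  induction n generalizing g with
  | zero => simp [truncOp, dualIter]
  | succ n ih =>
    rw [Function.iterate_succ_apply, ih (continuous_truncOp θ hg),
      integral_mul_truncOp hθ (continuous_dualIter _ _) hg]
    rfl

theorem truncIter_zero_eq_integral_dualIter {θ : ℝ} (hθ : θ ≤ -1) (n : ℕ) :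
    truncIter θ (n + 1) 0 = ∫ y in (0 : ℝ)..1, dualIter (-θ⁻¹) n y := by
  rw [truncIter, iterate_truncOp_zero hθ n continuous_const]
  simp

theorem exists_bound_polyIter (k : ℕ) :
    ∃ M : ℝ, 0 ≤ M ∧ ∀ ε ∈ Icc (0 : ℝ) 1, ∀ y ∈ Icc (-1 : ℝ) 0, |polyIter (-1 - ε) k y| ≤ M := by
  have hc : Continuous fun z : ℝ × ℝ => polyIter (-1 - z.1) k z.2 :=
    (isPolyTwo_polyIter k).contDiff.continuous.comp
      (by fun_prop : Continuous fun z : ℝ × ℝ => (-1 - z.1, z.2))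
  obtain ⟨M, hM⟩ := (isCompact_Icc.prod isCompact_Icc :
    IsCompact (Icc (0 : ℝ) 1 ×ˢ Icc (-1 : ℝ) 0)).exists_bound_of_continuousOn hc.continuousOn
  refine ⟨max M 0, le_max_right _ _, fun ε hε y hy => (hM (ε, y) ⟨hε, hy⟩).trans (le_max_left _ _)⟩

/-- Bounds for a function on `[0, 1]` which is of order `ε` on `[0, 1]`, of order `ε²` on
`[0, 1 / (1 + ε)]` and of order `ε³` on `[ε, 1 / (1 + ε)]`. -/
def BoundaryBound (C ε : ℝ) (D : ℝ → ℝ) : Prop :=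
  ∀ x ∈ Icc (0 : ℝ) 1, |D x| ≤ C * ε ∧ ((1 + ε) * x ≤ 1 → |D x| ≤ C * ε ^ 2) ∧
    (ε ≤ x → (1 + ε) * x ≤ 1 → |D x| ≤ C * ε ^ 3)

theorem BoundaryBound.abs_integral_le_cube {C ε u : ℝ} {D : ℝ → ℝ} (h : BoundaryBound C ε D)
    (hD : Continuous D) (hC : 0 ≤ C) (hε : 0 < ε) (hu0 : 0 ≤ u) (hu : (1 + ε) * u ≤ 1) :
    |∫ x in (0 : ℝ)..u, D x| ≤ 2 * C * ε ^ 3 := by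
  have hu1 : u ≤ 1 := by nlinarith
  set v := min u ε
  have hv0 : 0 ≤ v := le_min hu0 hε.le
  have hvu : v ≤ u := min_le_left _ _
  have hvε : v ≤ ε := min_le_right _ _
  rw [← intervalIntegral.integral_add_adjacent_intervals (hD.intervalIntegrable 0 v)
    (hD.intervalIntegrable v u)]
  have h1 : ‖∫ x in (0 : ℝ)..v, D x‖ ≤ C * ε ^ 2 * |v - 0| := by
    refine intervalIntegral.norm_integral_le_of_norm_le_const fun x hx => ?_
    rw [uIoc_of_le hv0] at hx
    exact (h x ⟨hx.1.le, by linarith [hx.2]⟩).2.1 (by nlinarith [hx.2])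
  have h2 : ‖∫ x in v..u, D x‖ ≤ C * ε ^ 3 * |u - v| := by
    refine intervalIntegral.norm_integral_le_of_norm_le_const fun x hx => ?_
    rw [uIoc_of_le hvu] at hx
    refine (h x ⟨by linarith [hx.1], by linarith [hx.2]⟩).2.2 ?_ (by nlinarith [hx.2])
    rcases min_lt_iff.1 hx.1 with h' | h'
    · linarith [hx.2]
    · exact h'.le
  rw [abs_of_nonneg (by linarith)] at h1 h2
  have h3 : C * ε ^ 2 * (v - 0) ≤ C * ε ^ 2 * ε := by
    rw [sub_zero]; exact mul_le_mul_of_nonneg_left hvε (by positivity)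
  have h4 : C * ε ^ 3 * (u - v) ≤ C * ε ^ 3 * 1 :=
    mul_le_mul_of_nonneg_left (by linarith) (by positivity)
  calc _ ≤ _ := abs_add_le _ _
    _ ≤ C * ε ^ 2 * ε + C * ε ^ 3 * 1 := add_le_add (h1.trans h3) (h2.trans h4)
    _ = _ := by ring

theorem BoundaryBound.abs_integral_le_sq {C ε u : ℝ} {D : ℝ → ℝ} (h : BoundaryBound C ε D)
    (hD : Continuous D) (hC : 0 ≤ C) (hε : 0 < ε) (hε1 : ε ≤ 1) (hu0 : 0 ≤ u) (hu : u ≤ 1) :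
    |∫ x in (0 : ℝ)..u, D x| ≤ 3 * C * ε ^ 2 := by
  have hcube : 2 * C * ε ^ 3 ≤ 2 * C * ε ^ 2 :=
    mul_le_mul_of_nonneg_left (pow_le_pow_of_le_one hε.le hε1 (by norm_num)) (by positivity)
  have hsq : 0 ≤ C * ε ^ 2 := by positivity
  rcases le_total ((1 + ε) * u) 1 with hu' | hu'
  · linarith [h.abs_integral_le_cube hD hC hε hu0 hu']
  set a := (1 + ε)⁻¹
  have ha : (1 + ε) * a = 1 := mul_inv_cancel₀ (by linarith)
  have ha0 : 0 ≤ a := by positivity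
  have hau : a ≤ u := by nlinarith
  rw [← intervalIntegral.integral_add_adjacent_intervals (hD.intervalIntegrable 0 a)
    (hD.intervalIntegrable a u)]
  have h1 := h.abs_integral_le_cube hD hC hε ha0 ha.le
  have h2 : ‖∫ x in a..u, D x‖ ≤ C * ε * |u - a| := by
    refine intervalIntegral.norm_integral_le_of_norm_le_const fun x hx => ?_
    rw [uIoc_of_le hau] at hx
    exact (h x ⟨by linarith [hx.1], by linarith [hx.2]⟩).1
  rw [abs_of_nonneg (by linarith)] at h2
  have h3 : C * ε * (u - a) ≤ C * ε * ε :=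
    mul_le_mul_of_nonneg_left (by nlinarith) (by positivity)
  calc _ ≤ _ := abs_add_le _ _
    _ ≤ 2 * C * ε ^ 3 + C * ε * ε := add_le_add h1 (h2.trans h3)
    _ ≤ _ := by nlinarith

theorem continuous_polyIter_sub_truncIter (θ : ℝ) (k : ℕ) :
    Continuous fun x => polyIter θ k x - truncIter θ k x :=
  (continuous_polyIter θ k).sub (continuous_truncIter θ k)

theorem polyIter_sub_truncIter_succ_of_nonneg {θ x : ℝ} (k : ℕ) (hx : 0 ≤ 1 + θ * x) :
    polyIter θ (k + 1) x - truncIter θ (k + 1) x =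
      ∫ y in (0 : ℝ)..(1 + θ * x), (polyIter θ k y - truncIter θ k y) := by
  rw [truncIter_succ, truncOp, polyIter, max_eq_right hx,
    intervalIntegral.integral_sub ((continuous_polyIter θ k).intervalIntegrable _ _)
      ((continuous_truncIter θ k).intervalIntegrable _ _)]

theorem polyIter_sub_truncIter_succ_of_nonpos {θ x : ℝ} (k : ℕ) (hx : 1 + θ * x ≤ 0) :
    polyIter θ (k + 1) x - truncIter θ (k + 1) x = ∫ y in (0 : ℝ)..(1 + θ * x), polyIter θ k y := by
  rw [truncIter_succ, truncOp, polyIter, max_eq_left hx, intervalIntegral.integral_same, sub_zero]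

theorem exists_boundaryBound (k : ℕ) : ∃ C : ℝ, 0 ≤ C ∧ ∀ ε : ℝ, 0 < ε → ε ≤ 1 →
    BoundaryBound C ε fun x => polyIter (-1 - ε) k x - truncIter (-1 - ε) k x := by
  induction k with
  | zero => exact ⟨0, le_rfl, fun ε _ _ x _ => by simp [polyIter, truncIter_zero]⟩
  | succ k ih =>
    obtain ⟨C, hC, hB⟩ := ih
    obtain ⟨M, hM, hP⟩ := exists_bound_polyIter k
    refine ⟨3 * C + M, by positivity, fun ε hε hε1 x hx => ?_⟩
    have hD := continuous_polyIter_sub_truncIter (-1 - ε) k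
    have hsq : ε ^ 2 ≤ ε := by nlinarith
    have hsmall : (1 + ε) * x ≤ 1 →
        |polyIter (-1 - ε) (k + 1) x - truncIter (-1 - ε) (k + 1) x| ≤ 3 * C * ε ^ 2 := by
      intro h
      rw [polyIter_sub_truncIter_succ_of_nonneg k (by linarith)]
      exact (hB ε hε hε1).abs_integral_le_sq hD hC hε hε1 (by linarith) (by nlinarith [hx.1])
    refine ⟨?_, fun h => (hsmall h).trans ?_, fun h1 h2 => ?_⟩
    · dsimp only
      rcases le_total ((1 + ε) * x) 1 with h | h
      · refine (hsmall h).trans ?_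
        have : 3 * C * ε ^ 2 ≤ 3 * C * ε := mul_le_mul_of_nonneg_left hsq (by positivity)
        nlinarith [mul_nonneg hM hε.le]
      · have hle : 1 + (-1 - ε) * x ≤ 0 := by linarith
        have hge : -ε ≤ 1 + (-1 - ε) * x := by nlinarith [hx.2]
        rw [polyIter_sub_truncIter_succ_of_nonpos k hle]
        have : ‖∫ y in (0 : ℝ)..(1 + (-1 - ε) * x), polyIter (-1 - ε) k y‖ ≤
            M * |1 + (-1 - ε) * x - 0| := by
          refine intervalIntegral.norm_integral_le_of_norm_le_const fun y hy => ?_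
          rw [uIoc_of_ge hle] at hy
          exact hP ε ⟨hε.le, hε1⟩ y ⟨by linarith [hy.1], hy.2⟩
        rw [sub_zero, abs_of_nonpos hle] at this
        refine this.trans ?_
        have : M * -(1 + (-1 - ε) * x) ≤ M * ε := mul_le_mul_of_nonneg_left (by linarith) hM
        nlinarith [mul_nonneg hC hε.le]
    · exact mul_le_mul_of_nonneg_right (by linarith) (by positivity)
    · dsimp only
      rw [polyIter_sub_truncIter_succ_of_nonneg k (by linarith)]
      have hu : 1 + (-1 - ε) * x ≤ 1 - (1 + ε) * ε := by nlinarith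
      have hu' : (1 + ε) * (1 + (-1 - ε) * x) ≤ (1 + ε) * (1 - (1 + ε) * ε) :=
        mul_le_mul_of_nonneg_left hu (by linarith)
      refine ((hB ε hε hε1).abs_integral_le_cube hD hC hε (by linarith) ?_).trans
        (mul_le_mul_of_nonneg_right (by linarith) (by positivity))
      nlinarith [pow_pos hε 2, pow_pos hε 3]

/-- Second order expansion of the error made by dropping the truncation below `-1`. -/
theorem tendsto_truncIter_sub_polyIter_div_sq (m : ℕ) :
    Tendsto (fun ε => (truncIter (-1 - ε) (m + 2) 0 - polyIter (-1 - ε) (m + 2) 0) / ε ^ 2)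
      (𝓝[>] 0) (𝓝 (polyIter (-1) m 0 / 2)) := by
  set c := polyIter (-1) m 0
  obtain ⟨C, hC, hB⟩ := exists_boundaryBound (m + 1)
  have hlim : Tendsto (fun ε : ℝ => c / (2 * (1 + ε))) (𝓝[>] 0) (𝓝 (c / 2)) := by
    have : ContinuousAt (fun ε : ℝ => c / (2 * (1 + ε))) 0 := by
      refine ContinuousAt.div (by fun_prop) (by fun_prop) (by norm_num)
    simpa using this.tendsto.mono_left nhdsWithin_le_nhds
  refine (tendsto_iff_of_dist ?_).2 hlim
  rw [Metric.tendsto_nhds]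
  intro δ hδ
  have hcont : ∀ᶠ z : ℝ × ℝ in 𝓝 (0, 0), |polyIter (-1 - z.1) m z.2 - c| < δ / 2 := by
    have hc : Continuous fun z : ℝ × ℝ => polyIter (-1 - z.1) m z.2 :=
      (isPolyTwo_polyIter m).contDiff.continuous.comp
        (by fun_prop : Continuous fun z : ℝ × ℝ => (-1 - z.1, z.2))
    have := Metric.tendsto_nhds.1 (hc.tendsto (0, 0)) (δ / 2) (by positivity)
    simpa [Real.dist_eq, c] using this
  obtain ⟨η, hη, hball⟩ := Metric.eventually_nhds_iff.1 hcont
  have hsmall : ∀ᶠ ε : ℝ in 𝓝[>] 0, 0 < ε ∧ ε < η ∧ ε ≤ 1 ∧ 2 * C * ε < δ / 2 := by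
    have h1 : ∀ᶠ ε : ℝ in 𝓝[>] 0, ε < η := nhdsWithin_le_nhds (Iio_mem_nhds hη)
    have h2 : ∀ᶠ ε : ℝ in 𝓝[>] 0, ε < 1 := nhdsWithin_le_nhds (Iio_mem_nhds one_pos)
    have h3 : ∀ᶠ ε : ℝ in 𝓝[>] 0, 2 * C * ε < δ / 2 := by
      have : ContinuousAt (fun ε : ℝ => 2 * C * ε) 0 := by fun_prop
      exact nhdsWithin_le_nhds (this.eventually_lt continuousAt_const (by simpa using hδ))
    filter_upwards [self_mem_nhdsWithin, h1, h2, h3] with ε a b d e using ⟨a, b, d.le, e⟩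
  filter_upwards [hsmall] with ε ⟨hε, hεη, hε1, hεC⟩
  set θ := -1 - ε
  set a := (1 + ε)⁻¹
  have ha : (1 + ε) * a = 1 := mul_inv_cancel₀ (by linarith)
  have ha0 : 0 ≤ a := by positivity
  have ha1 : a ≤ 1 := by nlinarith
  have hD := continuous_polyIter_sub_truncIter θ (m + 1)
  have hsplit : polyIter θ (m + 2) 0 - truncIter θ (m + 2) 0 =
      (∫ x in (0 : ℝ)..a, (polyIter θ (m + 1) x - truncIter θ (m + 1) x)) +
      ∫ x in a..1, polyIter θ (m + 1) x := by
    rw [polyIter_sub_truncIter_succ_of_nonneg (m + 1) (by simp), mul_zero, add_zero,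
      ← intervalIntegral.integral_add_adjacent_intervals (hD.intervalIntegrable 0 a)
        (hD.intervalIntegrable a 1)]
    congr 1
    refine intervalIntegral.integral_congr fun x hx => ?_
    rw [uIcc_of_le ha1] at hx
    simp only [polyIter_sub_truncIter_succ_of_nonpos m
      (show 1 + θ * x ≤ 0 by simp only [θ]; nlinarith [hx.1])]
    rfl
  have hfirst := (hB ε hε hε1).abs_integral_le_cube hD hC hε ha0 ha.le
  have hinner : ∀ x ∈ Ioc a 1, |polyIter θ (m + 1) x - c * (1 + θ * x)| ≤ δ / 2 * ε := by
    intro x hx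
    have hle : 1 + θ * x ≤ 0 := by simp only [θ]; nlinarith [hx.1]
    have hge : -ε ≤ 1 + θ * x := by simp only [θ]; nlinarith [hx.2]
    have : ‖∫ y in (0 : ℝ)..(1 + θ * x), (polyIter θ m y - c)‖ ≤ δ / 2 * |1 + θ * x - 0| := by
      refine intervalIntegral.norm_integral_le_of_norm_le_const fun y hy => ?_
      rw [uIoc_of_ge hle] at hy
      refine (hball (y := (ε, y)) ?_).le
      rw [Prod.dist_eq, max_lt_iff, Real.dist_eq, Real.dist_eq, sub_zero, sub_zero,
        abs_of_pos hε, abs_of_nonpos hy.2]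
      exact ⟨hεη, by linarith [hy.1]⟩
    rw [intervalIntegral.integral_sub ((continuous_polyIter θ m).intervalIntegrable _ _)
      (continuous_const.intervalIntegrable _ _), intervalIntegral.integral_const, sub_zero,
      abs_of_nonpos hle, smul_eq_mul, mul_comm _ c] at this
    exact this.trans (mul_le_mul_of_nonneg_left (by linarith) (by positivity))
  have hsecond : ‖∫ x in a..1, (polyIter θ (m + 1) x - c * (1 + θ * x))‖ ≤
      δ / 2 * ε * |1 - a| := by
    refine intervalIntegral.norm_integral_le_of_norm_le_const fun x hx => ?_
    rw [uIoc_of_le ha1] at hx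
    exact hinner x hx
  have hlin : ∫ x in a..1, c * (1 + θ * x) = -(c / (2 * (1 + ε))) * ε ^ 2 := by
    rw [intervalIntegral.integral_const_mul, intervalIntegral.integral_add
      (continuous_const.intervalIntegrable _ _)
      ((by fun_prop : Continuous fun x => θ * x).intervalIntegrable _ _),
      intervalIntegral.integral_const_mul]
    simp only [intervalIntegral.integral_const, integral_id, θ, a, smul_eq_mul]
    have : 1 + ε ≠ 0 := by linarith
    field_simp
    ring
  rw [intervalIntegral.integral_sub ((continuous_polyIter θ _).intervalIntegrable _ _)
    ((by fun_prop : Continuous fun x => c * (1 + θ * x)).intervalIntegrable _ _), hlin,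
    abs_of_nonneg (by linarith)] at hsecond
  have hsecond' : δ / 2 * ε * (1 - a) ≤ δ / 2 * ε * ε :=
    mul_le_mul_of_nonneg_left (by nlinarith) (by positivity)
  have hε2 : 0 < ε ^ 2 := by positivity
  set I := ∫ x in (0 : ℝ)..a, (polyIter θ (m + 1) x - truncIter θ (m + 1) x)
  set J := ∫ x in a..1, polyIter θ (m + 1) x
  have hquot : (truncIter θ (m + 2) 0 - polyIter θ (m + 2) 0) / ε ^ 2 - c / (2 * (1 + ε)) =
      -(I + (J - -(c / (2 * (1 + ε))) * ε ^ 2)) / ε ^ 2 := by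
    rw [eq_div_iff hε2.ne', sub_mul, div_mul_cancel₀ _ hε2.ne']
    linear_combination -hsplit
  rw [Real.dist_0_eq_abs, abs_of_nonneg dist_nonneg, Real.dist_eq, hquot, abs_div, abs_neg,
    abs_of_pos hε2, div_lt_iff₀ hε2]
  calc _ ≤ _ := abs_add_le _ _
    _ ≤ 2 * C * ε ^ 3 + δ / 2 * ε * ε := add_le_add hfirst (hsecond.trans hsecond')
    _ = (2 * C * ε + δ / 2) * ε ^ 2 := by ring
    _ < δ * ε ^ 2 := mul_lt_mul_of_pos_right (by linarith) hε2

section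
variable {Ω : Type*} {mΩ : MeasurableSpace Ω}

/-- The event that the autoregressive sequence stays nonnegative up to time `n`. -/
def persistenceEvent (X : ℕ → Ω → ℝ) (θ : ℝ) (n : ℕ) : Set Ω :=
  {w | ∀ k : ℕ, 1 ≤ k → k ≤ n → 0 ≤ arProcess X θ k w}

theorem persistenceEvent_succ (X : ℕ → Ω → ℝ) (θ : ℝ) (n : ℕ) :
    persistenceEvent X θ (n + 1) =
      persistenceEvent X θ n ∩ {w | 0 ≤ θ * arProcess X θ n w + X n w} := by
  ext w
  constructor
  · exact fun h => ⟨fun k h1 h2 => h k h1 (by omega), h (n + 1) (by omega) le_rfl⟩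
  · rintro ⟨h1, h2⟩ k hk1 hk2
    rcases Nat.lt_or_ge n k with h | h
    · obtain rfl : k = n + 1 := by omega
      exact h2
    · exact h1 k hk1 h

/-- The `σ`-algebra generated by the first `n` innovations. -/
@[reducible]
def innovationPast (X : ℕ → Ω → ℝ) (n : ℕ) : MeasurableSpace Ω :=
  ⨆ i ∈ Iio n, MeasurableSpace.comap (X i) inferInstance

theorem innovationPast_mono (X : ℕ → Ω → ℝ) {m n : ℕ} (h : m ≤ n) :
    innovationPast X m ≤ innovationPast X n :=
  biSup_mono fun _ hi => lt_of_lt_of_le hi h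

theorem measurable_innovation (X : ℕ → Ω → ℝ) (n : ℕ) :
    Measurable[innovationPast X (n + 1)] (X n) :=
  (comap_measurable (X n)).mono
    (le_biSup (fun i => MeasurableSpace.comap (X i) inferInstance) (Nat.lt_succ_self n)) le_rfl

theorem measurable_arProcess_past (X : ℕ → Ω → ℝ) (θ : ℝ) (n : ℕ) :
    Measurable[innovationPast X n] (arProcess X θ n) := by
  induction n with
  | zero => exact measurable_const
  | succ n ih =>
    have h := ih.mono (innovationPast_mono X n.le_succ) le_rfl
    exact (h.const_mul θ).add (measurable_innovation X n)

theorem measurableSet_persistenceEvent_past (X : ℕ → Ω → ℝ) (θ : ℝ) (n : ℕ) :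
    MeasurableSet[innovationPast X n] (persistenceEvent X θ n) := by
  have : persistenceEvent X θ n = ⋂ k ∈ Icc 1 n, arProcess X θ k ⁻¹' Ici 0 := by
    ext w
    simp [persistenceEvent]
  rw [this]
  refine MeasurableSet.biInter (to_countable _) fun k hk => ?_
  exact (measurable_arProcess_past X θ k).mono (innovationPast_mono X hk.2) le_rfl measurableSet_Ici

theorem innovationPast_le {X : ℕ → Ω → ℝ} (hX : ∀ k, Measurable (X k)) (n : ℕ) :
    innovationPast X n ≤ mΩ :=
  iSup₂_le fun i _ => (hX i).comap_le

/-- The transition operator of the autoregressive sequence with innovation law `μ`, killed when it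
becomes negative. -/
noncomputable def killedKernel (μ : Measure ℝ) (θ : ℝ) (g : ℝ → ENNReal) (x : ℝ) : ENNReal :=
  ∫⁻ u, (Ici 0).indicator g (θ * x + u) ∂μ

theorem measurable_killedKernel (μ : Measure ℝ) [SFinite μ] (θ : ℝ) {g : ℝ → ENNReal}
    (hg : Measurable g) : Measurable (killedKernel μ θ g) := by
  refine Measurable.lintegral_prod_right'
    (f := fun z : ℝ × ℝ => (Ici 0).indicator g (θ * z.1 + z.2)) ?_
  exact (hg.indicator measurableSet_Ici).comp (by fun_prop)

theorem lintegral_persistenceEvent {P : Measure Ω} [IsProbabilityMeasure P] {X : ℕ → Ω → ℝ}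
    (hX : ∀ k, Measurable (X k)) (hindep : iIndepFun X P) {μ : Measure ℝ}
    (hμ : ∀ k, P.map (X k) = μ) (θ : ℝ) (n : ℕ) {g : ℝ → ENNReal} (hg : Measurable g) :
    ∫⁻ w in persistenceEvent X θ n, g (arProcess X θ n w) ∂P = (killedKernel μ θ)^[n] g 0 := by
  have : IsProbabilityMeasure μ := by
    rw [← hμ 0]; exact Measure.isProbabilityMeasure_map (hX 0).aemeasurable
  induction n generalizing g with
  | zero =>
    have : persistenceEvent X θ 0 = univ := by
      ext w; simp only [persistenceEvent, mem_ofPred_eq, mem_univ, iff_true]; omega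
    simp [this, arProcess]
  | succ n ih =>
    rw [Function.iterate_succ_apply, ← ih (measurable_killedKernel μ θ hg)]
    have hA' := measurableSet_persistenceEvent_past X θ n
    have hA : MeasurableSet (persistenceEvent X θ n) := innovationPast_le hX n _ hA'
    have hA1 : MeasurableSet (persistenceEvent X θ (n + 1)) :=
      innovationPast_le hX _ _ (measurableSet_persistenceEvent_past X θ (n + 1))
    have hY' := measurable_arProcess_past X θ n
    let Z : Ω → ℝ × ENNReal := fun w =>
      (arProcess X θ n w, (persistenceEvent X θ n).indicator (fun _ => 1) w)
    have hZ' : Measurable[innovationPast X n] Z :=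
      hY'.prodMk (measurable_const.indicator hA')
    have hZ : Measurable Z := hZ'.mono (innovationPast_le hX n) le_rfl
    have hind : IndepFun Z (X n) P := by
      have hsup : Indep (innovationPast X n)
          (⨆ i ∈ ({n} : Set ℕ), MeasurableSpace.comap (X i) inferInstance) P :=
        indep_iSup_of_disjoint (fun i => (hX i).comap_le) hindep.iIndep
          (by simp [Set.disjoint_singleton_right])
      rw [iSup_singleton] at hsup
      exact indep_of_indep_of_le_left hsup hZ'.comap_le
    have hmap : P.map (fun w => (Z w, X n w)) = (P.map Z).prod μ := by
      rw [(indepFun_iff_map_prod_eq_prod_map_map hZ.aemeasurable (hX n).aemeasurable).1 hind, hμ]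
    have hh : Measurable fun z : (ℝ × ENNReal) × ℝ =>
        z.1.2 * (Ici 0).indicator g (θ * z.1.1 + z.2) :=
      measurable_fst.snd.mul ((hg.indicator measurableSet_Ici).comp (by fun_prop))
    calc ∫⁻ w in persistenceEvent X θ (n + 1), g (arProcess X θ (n + 1) w) ∂P
        = ∫⁻ w, (Z w).2 * (Ici 0).indicator g (θ * (Z w).1 + X n w) ∂P := by
          rw [← lintegral_indicator hA1]
          congr 1
          ext w
          rw [persistenceEvent_succ]
          by_cases h1 : w ∈ persistenceEvent X θ n <;>
            by_cases h2 : 0 ≤ θ * arProcess X θ n w + X n w <;>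
            simp [Z, h1, h2, indicator, arProcess]
      _ = ∫⁻ z, z.1.2 * (Ici 0).indicator g (θ * z.1.1 + z.2) ∂(P.map Z).prod μ := by
          rw [← hmap, lintegral_map hh (hZ.prodMk (hX n))]
      _ = ∫⁻ z, z.2 * killedKernel μ θ g z.1 ∂P.map Z := by
          rw [lintegral_prod _ hh.aemeasurable]
          congr 1
          ext z
          have hm : Measurable fun u => (Ici 0).indicator g (θ * z.1 + u) :=
            (hg.indicator measurableSet_Ici).comp (by fun_prop)
          exact lintegral_const_mul (μ := μ) z.2 hm
      _ = ∫⁻ w in persistenceEvent X θ n, killedKernel μ θ g (arProcess X θ n w) ∂P := by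
          have hk : Measurable fun z : ℝ × ENNReal => z.2 * killedKernel μ θ g z.1 :=
            measurable_snd.mul ((measurable_killedKernel μ θ hg).comp measurable_fst)
          rw [lintegral_map hk hZ, ← lintegral_indicator hA]
          congr 1
          ext w
          by_cases h1 : w ∈ persistenceEvent X θ n <;> simp [Z, h1]

theorem lintegral_uniform (f : ℝ → ENNReal) :
    ∫⁻ u, f u ∂(ProbabilityTheory.cond volume (Icc (-1 : ℝ) 1)) = (2 : ENNReal)⁻¹ * ∫⁻ u in Icc (-1 : ℝ) 1, f u := by
  rw [ProbabilityTheory.cond, lintegral_smul_measure, Real.volume_Icc]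
  norm_num

theorem killedKernel_uniform {θ x : ℝ} (hx : θ * x ≤ 1) {f : ℝ → ℝ} {g : ℝ → ENNReal}
    (hf : Continuous f) (hf0 : ∀ y, 0 ≤ f y)
    (hfg : ∀ y, 0 ≤ y → y ≤ 1 + θ * x → g y = ENNReal.ofReal (f y)) :
    killedKernel (ProbabilityTheory.cond volume (Icc (-1 : ℝ) 1)) θ g x = ENNReal.ofReal (2⁻¹ * truncOp θ f x) := by
  have hshift : ∫⁻ u in Icc (-1 : ℝ) 1, (Ici 0).indicator g (θ * x + u) =
      ∫⁻ y in Icc 0 (1 + θ * x), ENNReal.ofReal (f y) := by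
    rw [← lintegral_indicator measurableSet_Icc, ← lintegral_indicator measurableSet_Icc,
      ← lintegral_add_left_eq_self ((Icc 0 (1 + θ * x)).indicator _) (θ * x)]
    congr 1
    ext u
    by_cases h0 : 0 ≤ θ * x + u <;> by_cases h1 : u ≤ 1
    · have h2 : -1 ≤ u := by linarith
      have h3 : θ * x + u ≤ 1 + θ * x := by linarith
      simp [indicator, h0, h1, h2, h3, hfg _ h0 h3]
    · have h3 : ¬ θ * x + u ≤ 1 + θ * x := by linarith
      simp [indicator, h1, h3]
    · simp [indicator, h0]
    · simp [indicator, h0]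
  have hIcc : (Icc 0 (1 + θ * x) : Set ℝ) =ᵐ[volume] Ioc 0 (max 0 (1 + θ * x)) := by
    rcases le_total 0 (1 + θ * x) with h | h
    · rw [max_eq_right h]; exact Ioc_ae_eq_Icc.symm
    · rw [max_eq_left h, Ioc_self]
      rw [ae_eq_empty]
      have : Icc 0 (1 + θ * x) ⊆ {(0 : ℝ)} := fun y hy => le_antisymm (hy.2.trans h) hy.1
      exact measure_mono_null this (measure_singleton _)
  rw [killedKernel, lintegral_uniform, hshift, setLIntegral_congr hIcc,
    ← ofReal_integral_eq_lintegral_ofReal ?_ (ae_of_all _ hf0),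
    ENNReal.ofReal_mul (by norm_num), truncOp, intervalIntegral.integral_of_le (le_max_left _ _),
    ENNReal.ofReal_inv_of_pos two_pos, ENNReal.ofReal_ofNat]
  exact (hf.integrableOn_Icc (a := 0) (b := max 0 (1 + θ * x))).mono_set Ioc_subset_Icc_self

theorem killedKernel_uniform_iterate {θ b : ℝ}
    (hb : ∀ x ∈ Icc 0 b, θ * x ≤ 1 ∧ 1 + θ * x ≤ b) (n : ℕ) {x : ℝ} (hx : x ∈ Icc 0 b) :
    (killedKernel (ProbabilityTheory.cond volume (Icc (-1 : ℝ) 1)) θ)^[n] (fun _ => 1) x =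
      ENNReal.ofReal (2⁻¹ ^ n * truncIter θ n x) := by
  induction n generalizing x with
  | zero => simp [truncIter_zero]
  | succ n ih =>
    rw [Function.iterate_succ_apply', killedKernel_uniform (hb x hx).1
      ((continuous_truncIter θ n).const_mul (2⁻¹ ^ n))
      (fun y => mul_nonneg (by positivity) (truncIter_nonneg θ n y))
      (fun y h0 h1 => ih ⟨h0, h1.trans (hb x hx).2⟩), truncIter_succ, truncOp, truncOp,
      intervalIntegral.integral_const_mul]
    congr 1
    ring

theorem persistenceProb_eq_truncIter {P : Measure Ω} [IsProbabilityMeasure P] {X : ℕ → Ω → ℝ}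
    (hX : ∀ k, Measurable (X k)) (hindep : iIndepFun X P)
    (hunif : ∀ k, pdf.IsUniform (X k) (Icc (-1 : ℝ) 1) P volume) {θ : ℝ} (hθ : θ ≤ 1 / 2) (n : ℕ) :
    persistenceProb P X n θ = truncIter θ n 0 / 2 ^ n := by
  obtain ⟨b, hb0, hb⟩ : ∃ b : ℝ, 0 ≤ b ∧ ∀ x ∈ Icc 0 b, θ * x ≤ 1 ∧ 1 + θ * x ≤ b := by
    rcases le_total θ 0 with h | h
    · refine ⟨1, zero_le_one, fun x hx => ?_⟩
      constructor <;> nlinarith [hx.1, hx.2]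
    · refine ⟨2, zero_le_two, fun x hx => ?_⟩
      constructor <;> nlinarith [hx.1, hx.2]
  have h := lintegral_persistenceEvent hX hindep hunif θ n (measurable_const (a := (1 : ENNReal)))
  rw [killedKernel_uniform_iterate hb n ⟨le_rfl, hb0⟩] at h
  simp only [lintegral_one, Measure.restrict_apply_univ] at h
  change P.real (persistenceEvent X θ n) = _
  rw [measureReal_def, h, ENNReal.toReal_ofReal
    (mul_nonneg (by positivity) (truncIter_nonneg θ n 0)), inv_pow, inv_mul_eq_div]

end

theorem ContDiffOn.hasDerivAt_deriv {f : ℝ → ℝ} {u : Set ℝ} (hu : IsOpen u)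
    (hf : ContDiffOn ℝ ∞ f u) {x : ℝ} (hx : x ∈ u) : HasDerivAt f (deriv f x) x :=
  ((hf.contDiffAt (hu.mem_nhds hx)).differentiableAt (by simp)).hasDerivAt

theorem ContDiffOn.deriv_infty {f : ℝ → ℝ} {u : Set ℝ} (hu : IsOpen u)
    (hf : ContDiffOn ℝ ∞ f u) : ContDiffOn ℝ ∞ (deriv f) u :=
  ((contDiffOn_infty_iff_deriv_of_isOpen hu).1 hf).2

theorem iteratedDeriv_two_eq (f : ℝ → ℝ) : iteratedDeriv 2 f = deriv (deriv f) := by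
  rw [iteratedDeriv_succ, iteratedDeriv_one]

theorem contDiffOn_one_of_glue {f A B : ℝ → ℝ} {u : Set ℝ} {a : ℝ} (hu : IsOpen u) (ha : a ∈ u)
    (hA : ContDiffOn ℝ ∞ A u) (hB : ContDiffOn ℝ ∞ B u) (hfA : ∀ x ∈ u, a ≤ x → f x = A x)
    (hfB : ∀ x ∈ u, x ≤ a → f x = B x) (hd : deriv A a = deriv B a) : ContDiffOn ℝ 1 f u := by
  have hder : ∀ x ∈ u,
      HasDerivAt f (deriv A (max x a) + deriv B (min x a) - deriv A a) x := by
    intro x hx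
    rcases lt_trichotomy x a with h | rfl | h
    · rw [max_eq_right h.le, min_eq_left h.le, add_sub_cancel_left]
      refine (hB.hasDerivAt_deriv hu hx).congr_of_eventuallyEq ?_
      filter_upwards [hu.mem_nhds hx, Iio_mem_nhds h] with y hy hy' using hfB y hy hy'.le
    · rw [max_self, min_self, add_sub_cancel_left]
      have h1 : HasDerivWithinAt f (deriv B x) (u ∩ Iic x) x :=
        (hB.hasDerivAt_deriv hu hx).hasDerivWithinAt.congr (fun y hy => hfB y hy.1 hy.2)
          (hfB x hx le_rfl)
      have h2 : HasDerivWithinAt f (deriv B x) (u ∩ Ici x) x := by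
        rw [← hd]
        exact (hA.hasDerivAt_deriv hu hx).hasDerivWithinAt.congr (fun y hy => hfA y hy.1 hy.2)
          (hfA x hx le_rfl)
      have h3 := h1.union h2
      rw [← inter_union_distrib_left, Iic_union_Ici, inter_univ] at h3
      exact h3.hasDerivAt (hu.mem_nhds hx)
    · rw [max_eq_left h.le, min_eq_right h.le, ← hd, add_sub_cancel_right]
      refine (hA.hasDerivAt_deriv hu hx).congr_of_eventuallyEq ?_
      filter_upwards [hu.mem_nhds hx, Ioi_mem_nhds h] with y hy hy' using hfA y hy hy'.le
  rw [← zero_add (1 : ℕ∞ω), contDiffOn_succ_iff_deriv_of_isOpen hu]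
  refine ⟨fun x hx => (hder x hx).differentiableAt.differentiableWithinAt, by simp, ?_⟩
  refine contDiffOn_zero.2 (ContinuousOn.congr ?_ fun x hx => (hder x hx).deriv)
  refine ContinuousOn.sub (ContinuousOn.add ?_ ?_) continuousOn_const
  · refine (hA.deriv_infty hu).continuousOn.comp (by fun_prop) fun x hx => ?_
    rcases max_choice x a with h | h <;> rwa [h]
  · refine (hB.deriv_infty hu).continuousOn.comp (by fun_prop) fun x hx => ?_
    rcases min_choice x a with h | h <;> rwa [h]

theorem derivs_of_tendsto_div_sq {g : ℝ → ℝ} {u : Set ℝ} {a L : ℝ} (hu : IsOpen u) (ha : a ∈ u)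
    (hg : ContDiffOn ℝ ∞ g u) (h : Tendsto (fun x => g x / (x - a) ^ 2) (𝓝[<] a) (𝓝 L)) :
    deriv g a = 0 ∧ deriv (deriv g) a = 2 * L := by
  have hlin : Tendsto (fun x : ℝ => x - a) (𝓝[<] a) (𝓝 0) := by
    have : Continuous fun x : ℝ => x - a := by fun_prop
    simpa using (this.tendsto a).mono_left nhdsWithin_le_nhds
  have hne : ∀ᶠ x in 𝓝[<] a, x - a ≠ 0 := by
    filter_upwards [self_mem_nhdsWithin] with x hx using sub_ne_zero.2 (ne_of_lt hx)
  have hslope : Tendsto (fun x => g x / (x - a)) (𝓝[<] a) (𝓝 0) := by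
    have := h.mul hlin
    rw [mul_zero] at this
    refine this.congr' ?_
    filter_upwards [hne] with x hx
    field_simp
  have hlim : Tendsto g (𝓝[<] a) (𝓝 0) := by
    have := hslope.mul hlin
    rw [mul_zero] at this
    refine this.congr' ?_
    filter_upwards [hne] with x hx using div_mul_cancel₀ _ hx
  have hga : g a = 0 := tendsto_nhds_unique
    (((hg.continuousOn.continuousAt (hu.mem_nhds ha)).tendsto).mono_left nhdsWithin_le_nhds) hlim
  have hslope_of : ∀ {k : ℝ → ℝ} {d : ℝ}, HasDerivAt k d a → k a = 0 →
      Tendsto (fun x => k x / (x - a)) (𝓝[<] a) (𝓝 d) := by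
    intro k d hk hk0
    have := (hasDerivAt_iff_tendsto_slope.1 hk).mono_left
      (nhdsWithin_mono a (fun x (hx : x < a) => ne_of_lt hx))
    refine this.congr fun x => ?_
    rw [slope_def_field, hk0, sub_zero]
  have hd0 : deriv g a = 0 :=
    tendsto_nhds_unique (hslope_of (hg.hasDerivAt_deriv hu ha) hga) hslope
  refine ⟨hd0, ?_⟩
  have hd2 := (hslope_of ((hg.deriv_infty hu).hasDerivAt_deriv hu ha) hd0).div_const 2
  have hlhop : Tendsto (fun x => g x / (x - a) ^ 2) (𝓝[<] a) (𝓝 (deriv (deriv g) a / 2)) := by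
    refine HasDerivAt.lhopital_zero_nhdsLT (f' := deriv g) (g' := fun x => 2 * (x - a)) ?_ ?_ ?_
      hlim ?_ ?_
    · filter_upwards [nhdsWithin_le_nhds (hu.mem_nhds ha)] with x hx using hg.hasDerivAt_deriv hu hx
    · filter_upwards with x
      simpa using ((hasDerivAt_id' x).sub_const a).fun_pow 2
    · filter_upwards [hne] with x hx using mul_ne_zero two_ne_zero hx
    · simpa using hlin.pow 2
    · refine hd2.congr fun x => ?_
      rw [div_div, mul_comm]
  linarith [tendsto_nhds_unique h hlhop]

/-- The value of `2ⁿ⁺¹ pₙ₊₁(θ)` for `θ ≤ -1`, as a rational function of `θ`. -/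
noncomputable def dualVolume (n : ℕ) (θ : ℝ) : ℝ := ∫ y in (0 : ℝ)..1, dualIter (-θ⁻¹) n y

theorem contDiffOn_dualVolume (n : ℕ) : ContDiffOn ℝ ∞ (dualVolume n) (Iio 0) := by
  refine (contDiff_integral_dualIter n).comp_contDiffOn ?_
  exact (contDiffOn_id.inv fun x hx => ne_of_lt hx).neg

theorem tendsto_dualVolume_sub_polyIter_div_sq (m : ℕ) :
    Tendsto (fun θ => (dualVolume (m + 1) θ - polyIter θ (m + 2) 0) / (θ - -1) ^ 2)
      (𝓝[<] (-1)) (𝓝 (polyIter (-1) m 0 / 2)) := by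
  have hsub : Tendsto (fun θ : ℝ => -1 - θ) (𝓝[<] (-1)) (𝓝[>] 0) := by
    refine tendsto_nhdsWithin_iff.2 ⟨?_, ?_⟩
    · have : Continuous fun θ : ℝ => -1 - θ := by fun_prop
      simpa using (this.tendsto (-1)).mono_left nhdsWithin_le_nhds
    · filter_upwards [self_mem_nhdsWithin] with θ hθ
      exact sub_pos.2 (mem_Iio.1 hθ)
  refine ((tendsto_truncIter_sub_polyIter_div_sq m).comp hsub).congr' ?_
  filter_upwards [self_mem_nhdsWithin] with θ hθ
  have hθ' : -1 - (-1 - θ) = θ := by ring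
  simp only [Function.comp_apply, hθ']
  rw [truncIter_zero_eq_integral_dualIter (le_of_lt hθ) (m + 1), ← dualVolume]
  congr 1
  ring

theorem derivs_dualVolume (m : ℕ) :
    deriv (dualVolume (m + 1)) (-1) = deriv (fun θ => polyIter θ (m + 2) 0) (-1) ∧
    deriv (deriv (dualVolume (m + 1))) (-1) - deriv (deriv fun θ => polyIter θ (m + 2) 0) (-1) =
      polyIter (-1) m 0 := by
  have hu : IsOpen (Iio (0 : ℝ)) := isOpen_Iio
  have ha : (-1 : ℝ) ∈ Iio (0 : ℝ) := by norm_num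
  have hA := (contDiff_polyIter_zero (m + 2)).contDiffOn (s := Iio 0)
  have hB := contDiffOn_dualVolume (m + 1)
  obtain ⟨h1, h2⟩ := derivs_of_tendsto_div_sq hu ha (hB.sub hA)
    (tendsto_dualVolume_sub_polyIter_div_sq m)
  have hd : ∀ x ∈ Iio (0 : ℝ), deriv (fun θ => dualVolume (m + 1) θ - polyIter θ (m + 2) 0) x =
      deriv (dualVolume (m + 1)) x - deriv (fun θ => polyIter θ (m + 2) 0) x := fun x hx =>
    ((hB.hasDerivAt_deriv hu hx).sub (hA.hasDerivAt_deriv hu hx)).deriv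
  have hev : deriv (fun θ => dualVolume (m + 1) θ - polyIter θ (m + 2) 0) =ᶠ[𝓝 (-1 : ℝ)] fun x =>
      deriv (dualVolume (m + 1)) x - deriv (fun θ => polyIter θ (m + 2) 0) x := by
    filter_upwards [hu.mem_nhds ha] with x hx using hd x hx
  have hdd := hev.deriv_eq
  rw [hd _ ha] at h1
  have hdd' := ((hB.deriv_infty hu).hasDerivAt_deriv hu ha).sub
    ((hA.deriv_infty hu).hasDerivAt_deriv hu ha)
  refine ⟨sub_eq_zero.1 h1, ?_⟩
  rw [← hdd'.deriv]
  refine Eq.trans ?_ (h2.trans (by ring))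
  exact hdd.symm

theorem mainTheorem8 {Ω : Type*} [MeasurableSpace Ω] (P : Measure Ω) [IsProbabilityMeasure P]
    (X : ℕ → Ω → ℝ) (hX : ∀ k, Measurable (X k)) (hindep : iIndepFun X P)
    (hunif : ∀ k, pdf.IsUniform (X k) (Icc (-1 : ℝ) 1) P volume) :
    (∀ n : ℕ, ContDiffOn ℝ ∞ (persistenceProb P X n) (Iio (-1 : ℝ) ∪ Ioo (-1 : ℝ) (1 / 2))) ∧
    (∀ n : ℕ, 1 ≤ n → ContDiffAt ℝ 1 (persistenceProb P X n) (-1)) ∧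
    (∀ n : ℕ, 2 ≤ n →
      (¬ ContinuousAt (iteratedDeriv 2 (persistenceProb P X n)) (-1)) ∧
      (¬ ContDiffAt ℝ 2 (persistenceProb P X n) (-1)) ∧
      ∃ l r : ℝ,
        Tendsto (iteratedDeriv 2 (persistenceProb P X n)) (𝓝[<] (-1)) (𝓝 l) ∧
        Tendsto (iteratedDeriv 2 (persistenceProb P X n)) (𝓝[>] (-1)) (𝓝 r) ∧
        r < l ∧
        l - r = persistenceProb P X (n - 2) (-1) / 4) := by
  have hp : ∀ {θ : ℝ}, θ ≤ 1 / 2 → ∀ n, persistenceProb P X n θ = truncIter θ n 0 / 2 ^ n :=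
    fun hθ n => persistenceProb_eq_truncIter hX hindep hunif hθ n
  have hright : ∀ n θ, -1 ≤ θ → θ ≤ 1 / 2 →
      persistenceProb P X n θ = polyIter θ n 0 / 2 ^ n := fun n θ h1 h2 => by
    rw [hp h2, truncIter_zero_eq_polyIter h1 h2]
  have hleft : ∀ n θ, θ ≤ -1 →
      persistenceProb P X (n + 1) θ = dualVolume n θ / 2 ^ (n + 1) := fun n θ h => by
    rw [hp (by linarith), truncIter_zero_eq_integral_dualIter h, dualVolume]
  have hA : ∀ n, ContDiff ℝ ∞ fun θ => polyIter θ n 0 / 2 ^ n := fun n =>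
    (contDiff_polyIter_zero n).div_const _
  have hB : ∀ n, ContDiffOn ℝ ∞ (fun θ => dualVolume n θ / 2 ^ (n + 1)) (Iio 0) := fun n =>
    (contDiffOn_dualVolume n).div_const _
  have hu : IsOpen (Iio (0 : ℝ)) := isOpen_Iio
  have ha : (-1 : ℝ) ∈ Iio (0 : ℝ) := by norm_num
  refine ⟨fun n => ?_, fun n hn => ?_, fun n hn => ?_⟩
  · refine ContDiffOn.union_of_isOpen ?_ ?_ isOpen_Iio isOpen_Ioo
    · cases n with
      | zero =>
        refine (contDiffOn_const (c := (1 : ℝ))).congr fun θ hθ => ?_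
        rw [hp (by linarith [mem_Iio.1 hθ]), truncIter_zero]
        norm_num
      | succ n =>
        exact ((hB n).mono (Iio_subset_Iio (by norm_num))).congr fun θ hθ => hleft n θ (le_of_lt hθ)
    · exact (hA n).contDiffOn.congr fun θ hθ => hright n θ hθ.1.le hθ.2.le
  · obtain ⟨m, rfl⟩ : ∃ m, n = m + 1 := ⟨n - 1, by omega⟩
    refine (contDiffOn_one_of_glue hu ha (hA (m + 1)).contDiffOn (hB m) (fun x hx h => ?_)
      (fun x _ h => hleft m x h) ?_).contDiffAt (hu.mem_nhds ha)
    · exact hright _ x h (by linarith [mem_Iio.1 hx])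
    · rw [deriv_div_const, deriv_div_const]
      cases m with
      | zero =>
        have h1 : (fun θ => polyIter θ (0 + 1) 0) = fun _ => 1 := by ext θ; simp [polyIter]
        have h2 : dualVolume 0 = fun _ => 1 := by ext θ; simp [dualVolume, dualIter]
        rw [h1, h2]
      | succ m => rw [(derivs_dualVolume m).1]
  · obtain ⟨m, rfl⟩ : ∃ m, n = m + 2 := ⟨n - 2, by omega⟩
    set f := persistenceProb P X (m + 2)
    set A : ℝ → ℝ := fun θ => polyIter θ (m + 2) 0 / 2 ^ (m + 2) with hAdef
    set B : ℝ → ℝ := fun θ => dualVolume (m + 1) θ / 2 ^ (m + 2) with hBdef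
    have hl : Tendsto (iteratedDeriv 2 f) (𝓝[<] (-1)) (𝓝 (deriv (deriv B) (-1))) := by
      have hc := (((hB (m + 1)).deriv_infty hu).deriv_infty hu).continuousOn.continuousAt
        (hu.mem_nhds ha)
      refine (hc.tendsto.mono_left nhdsWithin_le_nhds).congr' ?_
      filter_upwards [self_mem_nhdsWithin] with x hx
      have : f =ᶠ[𝓝 x] B := by
        filter_upwards [Iio_mem_nhds hx] with y hy using hleft (m + 1) y (le_of_lt hy)
      rw [this.iteratedDeriv_eq 2, iteratedDeriv_two_eq]
    have hr : Tendsto (iteratedDeriv 2 f) (𝓝[>] (-1)) (𝓝 (deriv (deriv A) (-1))) := by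
      have hc := (((hA (m + 2)).contDiffOn.deriv_infty hu).deriv_infty hu).continuousOn.continuousAt
        (hu.mem_nhds ha)
      refine (hc.tendsto.mono_left nhdsWithin_le_nhds).congr' ?_
      filter_upwards [Ioo_mem_nhdsGT (show (-1 : ℝ) < 1 / 2 by norm_num)] with x hx
      have : f =ᶠ[𝓝 x] A := by
        filter_upwards [Ioo_mem_nhds hx.1 hx.2] with y hy using hright (m + 2) y hy.1.le hy.2.le
      rw [this.iteratedDeriv_eq 2, iteratedDeriv_two_eq]
    have hdd : ∀ h : ℝ → ℝ, deriv (deriv fun θ => h θ / 2 ^ (m + 2)) (-1) =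
        deriv (deriv h) (-1) / 2 ^ (m + 2) := fun h => by
      rw [← deriv_div_const]
      congr 1
      ext θ
      exact deriv_div_const _
    have hdiff : deriv (deriv B) (-1) - deriv (deriv A) (-1) =
        polyIter (-1) m 0 / 2 ^ (m + 2) := by
      rw [hAdef, hBdef, hdd, hdd, ← sub_div, (derivs_dualVolume m).2]
    have hlt : deriv (deriv A) (-1) < deriv (deriv B) (-1) := by
      rw [← sub_pos, hdiff]
      exact div_pos (polyIter_neg_one_pos m le_rfl one_pos) (by positivity)
    have hncont : ¬ ContinuousAt (iteratedDeriv 2 f) (-1) := fun hc =>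
      hlt.ne' <| (tendsto_nhds_unique hl (hc.tendsto.mono_left nhdsWithin_le_nhds)).trans
        (tendsto_nhds_unique hr (hc.tendsto.mono_left nhdsWithin_le_nhds)).symm
    refine ⟨hncont, fun hc => hncont ?_, _, _, hl, hr, hlt, ?_⟩
    · rw [iteratedDeriv_eq_equiv_comp]
      exact (LinearIsometryEquiv.continuous _).continuousAt.comp
        (hc.continuousAt_iteratedFDeriv (k := 2) (by norm_num))
    · rw [hdiff, Nat.add_sub_cancel, hright m (-1) le_rfl (by norm_num)]
      rw [pow_add, ← div_div]
      norm_num
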